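/- All graphs are finite and simple; an oriented graph is a directed graph without directed cycles of length $1$ or $2$, and connectivity, bipartiteness and planarity of an oriented graph refer to its underlying undirected graph. A graph is $2$-vertex-connected if it has at least two vertices, is connected, and has no cut-vertex (a vertex whose removal disconnects the graph); in particular the single edge $K_2$ is $2$-vertex-connected and $K_1$ is not. A planar triangulation is a connected planar graph on at least three vertices with a planar embedding all of whose faces, including the outer one, are triangles; an oriented planar triangulation is an oriented graph whose underlying graph is a planar triangulation. An undirected graph is Eulerian if it is connected and every vertex has even degree; an oriented graph is Eulerian if it is connected and at every vertex the in-degree equals the out-degree. A tripartition of a graph is a partition of its vertex set into three independent sets. (1) A graph $H$ is isomorphic to the subgraph induced by two of the three parts of a tripartition of some Eulerian planar triangulation if and only if $H$ is $2$-vertex-connected, bipartite and planar. (2) An oriented graph $H$ is isomorphic (as an oriented graph) to the subdigraph induced by two of the three parts of a tripartition of some Eulerian oriented planar triangulation if and only if $H$ is $2$-vertex-connected, bipartite and planar. -/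

import Mathlib

/-- A rotation system (combinatorial embedding) of a simple graph: at every vertex `v` the darts
leaving `v` are arranged in one cyclic order; `next` sends a dart to its successor around its
initial vertex. -/
structure RotationSystem {V : Type*} (G : SimpleGraph V) where
  next : Equiv.Perm G.Dart
  next_fst : ∀ d, (next d).fst = d.fst
  sameCycle : ∀ d d' : G.Dart, d.fst = d'.fst → next.SameCycle d d'

universe u

namespace RotationSystem

variable {V : Type*} {G : SimpleGraph V}

/-- Reversal of darts as a permutation. -/
def reverse (G : SimpleGraph V) : Equiv.Perm G.Dart :=
  Function.Involutive.toPerm SimpleGraph.Dart.symm SimpleGraph.Dart.symm_involutive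

/-- The face permutation: traverse a dart `(u, v)`, then continue along the dart that follows
`(v, u)` in the cyclic order at `v`. Its cycles are the facial walks. -/
def facePerm (R : RotationSystem G) : Equiv.Perm G.Dart :=
  (reverse G).trans R.next

/-- The facial walks of the rotation system (as cycles of darts). -/
def Face (R : RotationSystem G) : Type _ :=
  Quotient (Equiv.Perm.SameCycle.setoid R.facePerm)

/-- The set of darts of the facial walk through `d`; its size is the length of that walk. -/
def faceOf (R : RotationSystem G) (d : G.Dart) : Set G.Dart :=
  {d' | R.facePerm.SameCycle d d'}

/-- The rotation system has genus zero: every component is embedded in a sphere. This is Euler's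
formula `|V| - |E| + |F| = 2` added up over all connected components. An isolated
vertex has exactly one face, which contains no dart and is therefore counted separately. -/
def IsPlanar [Finite V] (R : RotationSystem G) : Prop :=
  Nat.card V + (Nat.card R.Face + Nat.card {v : V // ∀ w, ¬ G.Adj v w}) =
    Nat.card G.edgeSet + 2 * Nat.card G.ConnectedComponent

end RotationSystem

namespace SimpleGraph

variable {V : Type*}

/-- A finite graph is planar if it has a combinatorial embedding of genus zero. -/
def IsPlanarGraph [Finite V] (G : SimpleGraph V) : Prop :=
  ∃ R : RotationSystem G, R.IsPlanar

/-- A planar triangulation: a connected simple planar graph on at least three vertices with a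
planar embedding all of whose faces (including the outer one) are triangles. -/
def IsPlanarTriangulation [Finite V] (G : SimpleGraph V) : Prop :=
  3 ≤ Nat.card V ∧ G.Connected ∧
    ∃ R : RotationSystem G, R.IsPlanar ∧ ∀ d : G.Dart, (R.faceOf d).ncard = 3

/-- A finite graph is Eulerian if it is connected and all its vertices have even degree. -/
def IsEulerianGraph [Finite V] (G : SimpleGraph V) : Prop :=
  G.Connected ∧ ∀ v, Even (G.neighborSet v).ncard

/-- A cut-vertex: a vertex whose removal disconnects the graph. -/
def IsCutVertex (G : SimpleGraph V) (v : V) : Prop :=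
  ¬ (G.induce {w | w ≠ v}).Preconnected

/-- A finite graph is 2-vertex-connected if it is connected, has at least two vertices and has no
cut-vertex. -/
def IsTwoVertexConnected [Finite V] (G : SimpleGraph V) : Prop :=
  2 ≤ Nat.card V ∧ G.Connected ∧ ∀ v, ¬ G.IsCutVertex v

/-- `H` is (isomorphic to) the subgraph induced by two parts of a tripartition (a partition of the
vertices into three independent sets, given as a proper 3-colouring) of some Eulerian planar
triangulation `G`; the parts other than the `i`-th one are kept. -/
def IsInducedByTwoParts {V : Type u} (H : SimpleGraph V) : Prop :=
  ∃ (W : Type u) (_ : Finite W) (G : SimpleGraph W) (C : G.Coloring (Fin 3)) (i : Fin 3),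
    G.IsPlanarTriangulation ∧ G.IsEulerianGraph ∧ Nonempty (H ≃g G.induce {w | C w ≠ i})

end SimpleGraph

namespace Digraph

variable {V : Type*}

/-- An oriented graph is a digraph without directed cycles of length 1 or 2. -/
def IsOriented (D : Digraph V) : Prop :=
  (∀ v, ¬ D.Adj v v) ∧ ∀ u v, D.Adj u v → ¬ D.Adj v u

/-- The subdigraph induced by a set of vertices. -/
def induceOn (D : Digraph V) (s : Set V) : Digraph s where
  Adj u v := D.Adj u v

/-- A finite oriented graph is Eulerian if it is connected and at every vertex the out-degree
equals the in-degree. -/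
def IsEulerianOriented [Finite V] (D : Digraph V) : Prop :=
  D.IsOriented ∧ D.toSimpleGraphInclusive.Connected ∧
    ∀ v, {w | D.Adj v w}.ncard = {w | D.Adj w v}.ncard

/-- The oriented analogue of `SimpleGraph.IsInducedByTwoParts`: the digraph `H` is isomorphic, with
its orientation, to the subdigraph induced by two parts of a tripartition of some Eulerian oriented
planar triangulation. -/
def IsInducedByTwoParts {V : Type u} (H : Digraph V) : Prop :=
  ∃ (W : Type u) (_ : Finite W) (D : Digraph W)
    (C : D.toSimpleGraphInclusive.Coloring (Fin 3)) (i : Fin 3),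
    D.toSimpleGraphInclusive.IsPlanarTriangulation ∧ D.IsEulerianOriented ∧
      Nonempty (H.Adj ≃r (D.induceOn {w | C w ≠ i}).Adj)

end Digraph

/-! An embedding is a pair of permutations of the darts, rotation and reversal, whose product has
the faces as cycles. Multiplying a permutation by a transposition splits or merges one cycle, and
this yields the nonnegativity of the genus (`numCycles_add_numCycles_add_numCycles_mul_le`).

Sufficiency. Let `H` be plane, bipartite and without cut-vertices. No facial walk of `H` repeats a
vertex: otherwise splitting that vertex along the face would give a connected map of negative genus
(`IsPlanar.eq_of_sameCycle_facePerm`). So a new vertex can be placed in each face and joined to all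
its corners without creating parallel edges. The result is a triangulation, and the new vertices
form the third colour class. Each triangle contains one old edge, and the triangles traversing it
from colour `0` to colour `1` partition all the edges. Directing each such triangle cyclically, in
accordance with the given direction of its old edge, makes the orientation a union of edge-disjoint
directed triangles, hence Eulerian.

Necessity. In a 3-coloured triangulation every facial triangle has all three colours, so around a
kept vertex the kept and deleted neighbours alternate. Taking every second dart gives a rotation
system of `H` whose faces are the deleted vertices, and Euler's formula carries over by counting
(`IsPlanarTriangulation.twoParts`). The neighbours of a vertex form a closed walk around it. Detours
along such walks show that `H` is connected and remains so after the removal of one vertex.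

The undirected statement follows from the oriented one: a bipartite graph has an orientation, and an
Eulerian orientation forces even degrees. -/

namespace Equiv.Perm

/-! ### Cycle counts of permutations and nonnegativity of the genus -/

variable {α : Type*}

/-- The number of cycles of a permutation, fixed points included. -/
noncomputable def numCycles (f : Perm α) : ℕ :=
  Nat.card (Quotient (SameCycle.setoid f))

theorem sameCycle_apply_self (f : Perm α) (x : α) : f.SameCycle x (f x) := ⟨1, by simp⟩

theorem numCycles_one : (1 : Perm α).numCycles = Nat.card α := by
  refine Nat.card_congr (Equiv.symm (Equiv.ofBijective (Quotient.mk _) ⟨fun x y h => ?_,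
    Quotient.mk_surjective⟩))
  exact sameCycle_one.1 (Quotient.exact h)

variable [Finite α]

theorem sameCycle_setoid_le_iff {f : Perm α} {r : Setoid α} :
    SameCycle.setoid f ≤ r ↔ ∀ x, r x (f x) := by
  refine ⟨fun h x => h (SameCycle.refl f x |>.trans ⟨1, by simp⟩), fun h x y hxy => ?_⟩
  obtain ⟨n, rfl⟩ := SameCycle.exists_nat_pow_eq hxy
  induction n with
  | zero => exact r.refl _
  | succ n ih =>
    rw [pow_succ', mul_apply]
    exact r.trans (ih ⟨n, by simp⟩) (h _)

variable [DecidableEq α]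

theorem sup_swap_eq_self {r : Setoid α} {a b : α} (h : r a b) :
    r ⊔ SameCycle.setoid (swap a b) = r := by
  refine sup_eq_left.2 (sameCycle_setoid_le_iff.2 fun x => ?_)
  rcases eq_or_ne x a with rfl | ha
  · simpa using h
  rcases eq_or_ne x b with rfl | hb
  · simpa using r.symm h
  · rw [swap_apply_of_ne_of_ne ha hb]

/-- The map `g` relabels the class of `b` as the class of `a`. Its kernel is the join, and its range
misses exactly the class of `b`. -/
theorem card_quotient_sup_swap_add_one {r : Setoid α} {a b : α} (h : ¬ r a b) :
    Nat.card (Quotient (r ⊔ SameCycle.setoid (swap a b))) + 1 = Nat.card (Quotient r) := by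
  classical
  let g : α → Quotient r := fun x =>
    if (Quotient.mk r x) = Quotient.mk r b then Quotient.mk r a else Quotient.mk r x
  have hab : Quotient.mk r a ≠ Quotient.mk r b := fun e => h (Quotient.exact e)
  have hker : r ⊔ SameCycle.setoid (swap a b) = Setoid.ker g := by
    have hsw : (r ⊔ SameCycle.setoid (swap a b)) b a :=
      (le_sup_right : SameCycle.setoid (swap a b) ≤ _)
        (show (swap a b).SameCycle b a from ⟨1, by simp⟩)
    have hr : ∀ {x y}, Quotient.mk r x = Quotient.mk r y →
        (r ⊔ SameCycle.setoid (swap a b)) x y := fun e =>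
      (le_sup_left : r ≤ _) (Quotient.exact e)
    have step : ∀ x, ∃ z, (r ⊔ SameCycle.setoid (swap a b)) x z ∧ g x = Quotient.mk r z := by
      intro x
      by_cases hx : Quotient.mk r x = Quotient.mk r b
      · exact ⟨a, Setoid.trans' _ (hr hx) hsw, if_pos hx⟩
      · exact ⟨x, Setoid.refl' _ x, if_neg hx⟩
    apply le_antisymm
    · refine sup_le (fun x y hxy => ?_) (sameCycle_setoid_le_iff.2 fun x => ?_)
      · have : Quotient.mk r x = Quotient.mk r y := Quotient.sound hxy
        simp only [Setoid.ker_def, g, this]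
      · rw [Setoid.ker_def]
        rcases eq_or_ne x a with rfl | ha
        · simp [g]
        rcases eq_or_ne x b with rfl | hb
        · simp [g]
        · rw [swap_apply_of_ne_of_ne ha hb]
    · intro x y hxy
      obtain ⟨z, hz, ez⟩ := step x
      obtain ⟨w, hw, ew⟩ := step y
      have : Quotient.mk r z = Quotient.mk r w := by rw [← ez, ← ew]; exact hxy
      exact Setoid.trans' _ hz (Setoid.trans' _ (hr this) (Setoid.symm' _ hw))
  have hrange : Set.range g = {Quotient.mk r b}ᶜ := by
    ext q
    refine ⟨?_, fun hq => ?_⟩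
    · rintro ⟨x, rfl⟩
      by_cases hx : Quotient.mk r x = Quotient.mk r b
      · simpa [g, hx] using hab
      · simp [g, hx]
    · induction q using Quotient.inductionOn with
      | h x => exact ⟨x, if_neg hq⟩
  rw [hker, Nat.card_congr (Setoid.quotientKerEquivRange g), hrange,
    Nat.card_coe_set_eq, ← Set.ncard_add_ncard_compl {Quotient.mk r b}, Set.ncard_singleton,
    add_comm]

theorem sup_swap_mul (f : Perm α) (a b : α) :
    SameCycle.setoid (swap a b * f) ⊔ SameCycle.setoid (swap a b) =
      SameCycle.setoid f ⊔ SameCycle.setoid (swap a b) := by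
  have key : ∀ g : Perm α, SameCycle.setoid (swap a b * g) ≤
      SameCycle.setoid g ⊔ SameCycle.setoid (swap a b) := fun g =>
    sameCycle_setoid_le_iff.2 fun x => Setoid.trans' _
      ((le_sup_left : SameCycle.setoid g ≤ _) (sameCycle_apply_self g x))
      ((le_sup_right : SameCycle.setoid (swap a b) ≤ _) (sameCycle_apply_self (swap a b) (g x)))
  refine le_antisymm (sup_le (key f) le_sup_right) (sup_le ?_ le_sup_right)
  simpa using key (swap a b * f)

/-- From `b` the new permutation follows the `f`-cycle of `b`; the step that would close this cycle
is diverted to `a`. -/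
theorem sameCycle_swap_mul_of_not_sameCycle {f : Perm α} {a b : α} (h : ¬ f.SameCycle a b) :
    (swap a b * f).SameCycle a b := by
  have hex : ∃ n, 0 < n ∧ (f ^ n) b = b :=
    ⟨orderOf f, orderOf_pos f, by simp [pow_orderOf_eq_one]⟩
  classical
  let p := Nat.find hex
  have hp : 0 < p ∧ (f ^ p) b = b := Nat.find_spec hex
  have hstep : ∀ j, j < p → ((swap a b * f) ^ j) b = (f ^ j) b := by
    intro j
    induction j with
    | zero => simp
    | succ j ih =>
      intro hj
      rw [pow_succ', mul_apply, ih (by omega), mul_apply, ← mul_apply f, ← pow_succ']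
      refine swap_apply_of_ne_of_ne (fun e => h ?_) fun e => Nat.find_min hex hj ⟨by omega, e⟩
      exact SameCycle.symm ⟨(j + 1 : ℕ), by rw [zpow_natCast]; exact e⟩
  refine SameCycle.symm ⟨p, ?_⟩
  obtain ⟨k, hk⟩ := Nat.exists_eq_succ_of_ne_zero hp.1.ne'
  have hk' : p = k + 1 := hk
  rw [zpow_natCast, hk', pow_succ', mul_apply, hstep k (by omega), mul_apply, ← mul_apply f,
    ← pow_succ', ← hk', hp.2, swap_apply_right]

/-- If `k` is the least exponent with `(f ^ k) a = b`, the step that would reach `b` returns to `a`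
instead, so the orbit of `a` closes up before meeting `b`. -/
theorem not_sameCycle_swap_mul_of_sameCycle {f : Perm α} {a b : α} (hab : a ≠ b)
    (h : f.SameCycle a b) : ¬ (swap a b * f).SameCycle a b := by
  have hex : ∃ n, (f ^ n) a = b := SameCycle.exists_nat_pow_eq h
  classical
  let k := Nat.find hex
  have hk : (f ^ k) a = b := Nat.find_spec hex
  have hmin : ∀ j, j < k → (f ^ j) a ≠ b := fun j hj => Nat.find_min hex hj
  have hk0 : k ≠ 0 := fun e => hab (by rw [e] at hk; simpa using hk)
  have hinv : ∀ n, ∃ j, j < k ∧ ((swap a b * f) ^ n) a = (f ^ j) a := by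
    intro n
    induction n with
    | zero => exact ⟨0, by omega, rfl⟩
    | succ n ih =>
      obtain ⟨j, hj, e⟩ := ih
      rw [pow_succ', mul_apply, e, mul_apply, ← mul_apply f, ← pow_succ']
      rcases eq_or_ne (j + 1) k with hjk | hjk
      · exact ⟨0, by omega, by rw [hjk, hk]; simp⟩
      · refine ⟨j + 1, by omega, swap_apply_of_ne_of_ne (fun ea => ?_) (hmin _ (by omega))⟩
        apply hmin (k - (j + 1)) (by omega)
        conv_lhs => rw [← ea]
        rw [← mul_apply, ← pow_add, Nat.sub_add_cancel (by omega), hk]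
  intro hs
  obtain ⟨n, hn⟩ := SameCycle.exists_nat_pow_eq hs
  obtain ⟨j, hj, e⟩ := hinv n
  exact hmin j hj (e ▸ hn)

theorem numCycles_swap_mul_of_not_sameCycle {f : Perm α} {a b : α} (h : ¬ f.SameCycle a b) :
    (swap a b * f).numCycles + 1 = f.numCycles := by
  rw [numCycles, numCycles, ← card_quotient_sup_swap_add_one (r := SameCycle.setoid f) h,
    ← sup_swap_mul, sup_swap_eq_self]
  exact sameCycle_swap_mul_of_not_sameCycle h

theorem numCycles_swap_mul_of_sameCycle {f : Perm α} {a b : α} (hab : a ≠ b)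
    (h : f.SameCycle a b) : (swap a b * f).numCycles = f.numCycles + 1 := by
  rw [← numCycles_swap_mul_of_not_sameCycle (not_sameCycle_swap_mul_of_sameCycle hab h)]
  simp

/-- The genus of a combinatorial (hyper)map is nonnegative. -/
theorem numCycles_add_numCycles_add_numCycles_mul_le (s a : Perm α) :
    s.numCycles + a.numCycles + (a * s).numCycles ≤
      Nat.card α + 2 * Nat.card (Quotient (SameCycle.setoid s ⊔ SameCycle.setoid a)) := by
  cases nonempty_fintype α
  induction hn : a.support.card using Nat.strong_induction_on generalizing a with
  | _ n ih =>
    by_cases ha : a = 1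
    · subst ha
      have : SameCycle.setoid s ⊔ SameCycle.setoid (1 : Perm α) = SameCycle.setoid s :=
        sup_eq_left.2 (sameCycle_setoid_le_iff.2 fun x => Setoid.refl' _ x)
      rw [this, numCycles_one, one_mul, numCycles]
      omega
    · obtain ⟨x, hx⟩ : ∃ x, a x ≠ x := by
        by_contra! hc
        exact ha (Equiv.ext hc)
      -- Removing `x` from its cycle leaves a permutation of smaller support with one more cycle.
      set b : Perm α := swap x (a x) * a with hb
      have hab : a = swap x (a x) * b := by simp [hb]
      have hfix : b x = x := by simp [hb]
      have hnb : ¬ b.SameCycle x (a x) := fun h => hx (h.eq_of_left hfix).symm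
      have hih := ih _ (hn ▸ card_support_swap_mul hx) b rfl
      have hz : a.numCycles + 1 = b.numCycles := by
        have := numCycles_swap_mul_of_not_sameCycle hnb
        rwa [← hab] at this
      have hsup : SameCycle.setoid s ⊔ SameCycle.setoid a =
          (SameCycle.setoid s ⊔ SameCycle.setoid b) ⊔ SameCycle.setoid (swap x (a x)) := by
        rw [sup_assoc, hb, sup_swap_mul, sup_swap_eq_self]
        exact sameCycle_apply_self a x
      have hmul : a * s = swap x (a x) * (b * s) := by rw [← mul_assoc, ← hab]
      -- Passing from `b` to `a` either keeps the left side and the orbits unchanged, or lowers the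
      -- left side by 2 while at most two orbits merge.
      by_cases hsame : (b * s).SameCycle x (a x)
      · have h1 := numCycles_swap_mul_of_sameCycle hx.symm hsame
        have hle : SameCycle.setoid (b * s) ≤ SameCycle.setoid s ⊔ SameCycle.setoid b :=
          sameCycle_setoid_le_iff.2 fun y => Setoid.trans' _
            ((le_sup_left : SameCycle.setoid s ≤ _) (sameCycle_apply_self s y))
            ((le_sup_right : SameCycle.setoid b ≤ _) (sameCycle_apply_self b (s y)))
        rw [hsup, sup_swap_eq_self (hle hsame), hmul]
        omega
      · have h1 := numCycles_swap_mul_of_not_sameCycle hsame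
        have h2 : Nat.card (Quotient (SameCycle.setoid s ⊔ SameCycle.setoid b)) ≤
            Nat.card (Quotient (SameCycle.setoid s ⊔ SameCycle.setoid a)) + 1 := by
          rw [hsup]
          by_cases hr : (SameCycle.setoid s ⊔ SameCycle.setoid b) x (a x)
          · rw [sup_swap_eq_self hr]; omega
          · rw [card_quotient_sup_swap_add_one hr]
        rw [hmul]
        omega

end Equiv.Perm

/-! ### Vertices, edges and faces as cycles; facial walks without cut-vertices -/

namespace SimpleGraph

variable {V : Type*} {G : SimpleGraph V}

theorem natCard_dart_eq_two_mul [Finite V] (G : SimpleGraph V) :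
    Nat.card G.Dart = 2 * Nat.card G.edgeSet := by
  classical
  cases nonempty_fintype V
  rw [Nat.card_eq_fintype_card, dart_card_eq_twice_card_edges, Nat.card_eq_fintype_card,
    edgeFinset_card]

instance [Finite V] : Finite G.Dart := by
  classical
  cases nonempty_fintype V
  infer_instance

theorem Connected.exists_dart_fst_eq [Nontrivial V] (h : G.Connected) (v : V) :
    ∃ d : G.Dart, d.fst = v := by
  obtain ⟨w, hw⟩ := h.preconnected.exists_adj_of_nontrivial v
  exact ⟨⟨(v, w), hw⟩, rfl⟩

end SimpleGraph

namespace RotationSystem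

open Equiv.Perm

variable {V : Type*} {G : SimpleGraph V}

theorem facePerm_apply (R : RotationSystem G) (d : G.Dart) : R.facePerm d = R.next d.symm := rfl

theorem facePerm_eq_mul (R : RotationSystem G) : R.facePerm = R.next * reverse G := rfl

theorem facePerm_fst (R : RotationSystem G) (d : G.Dart) : (R.facePerm d).fst = d.snd :=
  R.next_fst _

theorem fst_eq_of_sameCycle [Finite V] (R : RotationSystem G) {d d' : G.Dart}
    (h : R.next.SameCycle d d') : d.fst = d'.fst :=
  (sameCycle_setoid_le_iff (r := Setoid.ker fun d : G.Dart => d.fst)).2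
    (fun x => (R.next_fst x).symm) h

variable [Finite V]

theorem numCycles_next (R : RotationSystem G) (h : ∀ v, ∃ d : G.Dart, d.fst = v) :
    R.next.numCycles = Nat.card V := by
  refine Nat.card_congr (Equiv.ofBijective
    (Quotient.lift (fun d : G.Dart => d.fst) fun _ _ => R.fst_eq_of_sameCycle) ⟨?_, ?_⟩)
  · rintro ⟨d⟩ ⟨d'⟩ e
    exact Quotient.sound (R.sameCycle d d' e)
  · intro v
    obtain ⟨d, hd⟩ := h v
    exact ⟨Quotient.mk _ d, hd⟩

theorem natCard_edgeSet_le_numCycles_reverse (G : SimpleGraph V) :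
    Nat.card G.edgeSet ≤ (reverse G).numCycles := by
  refine Nat.card_le_card_of_surjective (α := Quotient (SameCycle.setoid (reverse G)))
    (Quotient.lift (fun d : G.Dart => (⟨d.edge, d.edge_mem⟩ : G.edgeSet))
      fun d d' h => ?_) ?_
  · exact (sameCycle_setoid_le_iff (r := Setoid.ker fun d : G.Dart =>
      (⟨d.edge, d.edge_mem⟩ : G.edgeSet))).2 (fun x => Subtype.ext x.edge_symm.symm) h
  · rintro ⟨e, he⟩
    induction e using Sym2.ind with
    | _ x y => exact ⟨Quotient.mk _ ⟨(x, y), he⟩, rfl⟩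

theorem isPlanar_iff_of_connected [Nontrivial V] (R : RotationSystem G) (h : G.Connected) :
    R.IsPlanar ↔ Nat.card V + R.facePerm.numCycles = Nat.card G.edgeSet + 2 := by
  have h0 : Nat.card {v : V // ∀ w, ¬ G.Adj v w} = 0 := by
    have : IsEmpty {v : V // ∀ w, ¬ G.Adj v w} := ⟨fun v => by
      obtain ⟨w, hw⟩ := h.preconnected.exists_adj_of_nontrivial v.1
      exact v.2 w hw⟩
    exact Nat.card_of_isEmpty
  have h1 : Nat.card G.ConnectedComponent = 1 := by
    have := h.preconnected.subsingleton_connectedComponent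
    have := h.nonempty
    exact Nat.card_of_subsingleton (G.connectedComponentMk (Classical.arbitrary V))
  rw [IsPlanar, h0, h1]
  rfl

/-- In a plane graph without cut-vertices no facial walk visits a vertex twice. -/
theorem IsPlanar.eq_of_sameCycle_facePerm [Nontrivial V] {R : RotationSystem G} (hR : R.IsPlanar)
    (hc : G.Connected) (hcut : ∀ v, ¬ G.IsCutVertex v) {d d' : G.Dart}
    (hface : R.facePerm.SameCycle d d') (hfst : d.fst = d'.fst) : d = d' := by
  classical
  by_contra hne
  -- The transposition cuts both the vertex and the face containing `d` and `d'` in two.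
  set s : Equiv.Perm G.Dart := Equiv.swap d d' * R.next with hs
  set r := SameCycle.setoid (reverse G) ⊔ SameCycle.setoid s with hr
  have h1 := numCycles_add_numCycles_add_numCycles_mul_le (reverse G) s
  have h2 : s.numCycles = Nat.card V + 1 := by
    rw [hs, numCycles_swap_mul_of_sameCycle hne (R.sameCycle d d' hfst),
      R.numCycles_next hc.exists_dart_fst_eq]
  have h3 : (s * reverse G).numCycles = R.facePerm.numCycles + 1 := by
    rw [hs, mul_assoc, ← facePerm_eq_mul, numCycles_swap_mul_of_sameCycle hne hface]
  have h4 := natCard_edgeSet_le_numCycles_reverse G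
  have h5 := (R.isPlanar_iff_of_connected hc).1 hR
  rw [h2, h3, SimpleGraph.natCard_dart_eq_two_mul, ← hr] at h1
  have hrev : ∀ x : G.Dart, r x x.symm := fun x =>
    (le_sup_left : SameCycle.setoid (reverse G) ≤ r) (sameCycle_apply_self (reverse G) x)
  have hrs : ∀ x : G.Dart, r x (s x) := fun x =>
    (le_sup_right : SameCycle.setoid s ≤ r) (sameCycle_apply_self s x)
  have hvert : ∀ x y : G.Dart, x.fst ≠ d.fst → x.fst = y.fst → r x y := by
    intro x y hx hxy
    obtain ⟨n, rfl⟩ := SameCycle.exists_nat_pow_eq (R.sameCycle x y hxy)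
    clear hxy
    induction n with
    | zero => exact r.refl _
    | succ n ih =>
      refine r.trans ih ?_
      have hf : ((R.next ^ (n + 1)) x).fst ≠ d.fst := by
        rwa [← R.fst_eq_of_sameCycle (d := x) ⟨(n + 1 : ℕ), by rw [zpow_natCast]⟩]
      have := hrs ((R.next ^ n) x)
      rwa [hs, mul_apply, ← mul_apply R.next, ← pow_succ', Equiv.swap_apply_of_ne_of_ne] at this
      · exact fun e => hf (by rw [e])
      · exact fun e => hf (by rw [e, hfst])
  -- Away from the split vertex the rotation is unchanged, and the graph without that vertex is
  -- connected.
  have hoff : ∀ x y : G.Dart, x.fst ≠ d.fst → y.fst ≠ d.fst → r x y := by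
    intro x y hx hy
    obtain ⟨p⟩ := not_not.1 (hcut d.fst) ⟨x.fst, hx⟩ ⟨y.fst, hy⟩
    suffices ∀ (a b : {w | w ≠ d.fst}), (G.induce {w | w ≠ d.fst}).Walk a b →
        ∀ x y : G.Dart, x.fst = a → y.fst = b → r x y from this _ _ p x y rfl rfl
    intro a b p
    induction p with
    | @nil a => exact fun x y hx hy => hvert x y (hx ▸ a.2) (hx.trans hy.symm)
    | @cons a b c hab p ih =>
      intro x y hx hy
      let z : G.Dart := ⟨(a, b), hab⟩
      exact r.trans (hvert x z (hx ▸ a.2) hx) (r.trans (hrev z) (ih z.symm y rfl hy))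
  have hall : ∀ x y : G.Dart, r x y := by
    have hz : ∀ x : G.Dart, ∃ z : G.Dart, z.fst ≠ d.fst ∧ r x z := by
      intro x
      by_cases hx : x.fst = d.fst
      · exact ⟨x.symm, fun e => x.adj.ne (hx.trans e.symm), hrev x⟩
      · exact ⟨x, hx, r.refl x⟩
    intro x y
    obtain ⟨z, hz1, hz2⟩ := hz x
    obtain ⟨w, hw1, hw2⟩ := hz y
    exact r.trans hz2 (r.trans (hoff z w hz1 hw1) (r.symm hw2))
  have h6 : Nat.card (Quotient r) ≤ 1 := by
    have : Subsingleton (Quotient r) := ⟨by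
      rintro ⟨x⟩ ⟨y⟩
      exact Quotient.sound (hall x y)⟩
    exact Finite.card_le_one_iff_subsingleton.2 this
  -- With one orbit the genus inequality reads `E + (V + 1) + (F + 1) ≤ 2E + 2`, against `V + F = E
  -- + 2`.
  omega

end RotationSystem

/-! ### Permutations with cycles of constant length, and maps between cycles -/

namespace Equiv.Perm

variable {α : Type*} [Finite α]

theorem ncard_setOf_sameCycle_eq_three {f : Perm α} {x : α} (h : f x ≠ x) (h3 : f (f (f x)) = x) :
    {y | f.SameCycle x y}.ncard = 3 := by
  have hset : {y | f.SameCycle x y} = {x, f x, f (f x)} := by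
    ext y
    constructor
    · intro hy
      obtain ⟨n, rfl⟩ := SameCycle.exists_nat_pow_eq hy
      clear hy
      induction n with
      | zero => simp
      | succ n ih =>
        rw [pow_succ', mul_apply]
        rcases ih with ih | ih | ih <;> rw [ih]
        · simp
        · simp
        · simp [h3]
    · rintro (rfl | rfl | rfl)
      · exact SameCycle.refl _ _
      · exact sameCycle_apply_self _ _
      · exact (sameCycle_apply_self _ _).trans (sameCycle_apply_self _ _)
  rw [hset, Set.ncard_eq_three]
  refine ⟨x, f x, f (f x), h.symm, fun e => h ?_, fun e => h (f.injective e.symm), rfl⟩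
  conv_lhs => rw [e]
  exact h3

theorem mul_numCycles_eq_natCard {f : Perm α} {k : ℕ} (h : ∀ x, {y | f.SameCycle x y}.ncard = k) :
    k * f.numCycles = Nat.card α := by
  have := Fintype.ofFinite (Quotient (SameCycle.setoid f))
  rw [← Nat.card_congr (Equiv.sigmaFiberEquiv (Quotient.mk (SameCycle.setoid f))), Nat.card_sigma]
  have hfib : ∀ q : Quotient (SameCycle.setoid f), Nat.card {x // Quotient.mk _ x = q} = k := by
    rintro ⟨x⟩
    rw [← h x, ← Nat.card_coe_set_eq]
    refine Nat.card_congr (Equiv.subtypeEquivRight fun y => ?_)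
    exact ⟨fun e => (Quotient.exact e).symm, fun e => Quotient.sound (SameCycle.symm e)⟩
  rw [Finset.sum_congr rfl fun q _ => hfib q]
  simp [numCycles, mul_comm, Nat.card_eq_fintype_card]

/-- One step of `f` may become several steps of `g`, or backward ones, so this covers more than
semiconjugacies. -/
theorem SameCycle.map {β : Type*} [Finite β] {f : Perm α} {g : Perm β} {φ : α → β}
    (h : ∀ x, g.SameCycle (φ x) (φ (f x))) {x y : α} (hxy : f.SameCycle x y) :
    g.SameCycle (φ x) (φ y) :=
  (sameCycle_setoid_le_iff (r := (SameCycle.setoid g).comap φ)).2 h hxy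

end Equiv.Perm

/-! ### The stellation of a plane graph -/

namespace RotationSystem

open Equiv.Perm

variable {V : Type*} {H : SimpleGraph V} (R : RotationSystem H)

/-- The graph obtained by placing a new vertex in each face and joining it to all the vertices on
the boundary of that face. -/
def stellation : SimpleGraph (V ⊕ R.Face) where
  Adj
    | .inl u, .inl v => H.Adj u v
    | .inl u, .inr f => ∃ d : H.Dart, d.fst = u ∧ Quotient.mk _ d = f
    | .inr f, .inl u => ∃ d : H.Dart, d.fst = u ∧ Quotient.mk _ d = f
    | .inr _, .inr _ => False
  symm := ⟨by
    rintro (u | f) (v | g) h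
    · exact SimpleGraph.Adj.symm h
    · exact h
    · exact h
    · exact h⟩
  loopless := ⟨by
    rintro (u | f) h
    · exact H.irrefl h
    · exact h⟩

/-- The darts of the stellation: the old darts, and for every corner of a face one dart towards the
new vertex and one dart from the new vertex. -/
def stellationDart : H.Dart ⊕ H.Dart ⊕ H.Dart → R.stellation.Dart
  | .inl d => ⟨(.inl d.fst, .inl d.snd), d.adj⟩
  | .inr (.inl d) => ⟨(.inl d.fst, .inr (Quotient.mk _ d)), ⟨d, rfl, rfl⟩⟩
  | .inr (.inr d) => ⟨(.inr (Quotient.mk _ d), .inl d.fst), ⟨d, rfl, rfl⟩⟩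

/-- The rotation at the vertices of the stellation. -/
def stellationNext : Equiv.Perm (H.Dart ⊕ H.Dart ⊕ H.Dart) where
  toFun
    -- The face through `next d` arrives along `d.symm`, so its spoke lies between `d` and `next d`.
    -- Around a new vertex the corners appear in reverse facial order.
    | .inl d => .inr (.inl (R.next d))
    | .inr (.inl d) => .inl d
    | .inr (.inr d) => .inr (.inr (R.facePerm.symm d))
  invFun
    | .inl d => .inr (.inl d)
    | .inr (.inl d) => .inl (R.next.symm d)
    | .inr (.inr d) => .inr (.inr (R.facePerm d))
  left_inv := by rintro (d | d | d) <;> simp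
  right_inv := by rintro (d | d | d) <;> simp

/-- No facial walk visits a vertex twice. -/
def FacesSimple : Prop :=
  ∀ d d' : H.Dart, R.facePerm.SameCycle d d' → d.fst = d'.fst → d = d'

variable {R}

theorem FacesSimple.eq_of_mk_eq (hR : R.FacesSimple) {d d' : H.Dart} (h : d.fst = d'.fst)
    (hf : (Quotient.mk _ d : R.Face) = Quotient.mk _ d') : d = d' :=
  hR d d' (Quotient.exact hf) h

/-- Two corners of one face at the same vertex would give the same spoke; `FacesSimple` excludes
this. -/
theorem FacesSimple.bijective_stellationDart (hR : R.FacesSimple) :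
    Function.Bijective R.stellationDart := by
  constructor
  · rintro (d | d | d) (d' | d' | d') h <;>
      simp only [stellationDart, SimpleGraph.Dart.ext_iff, Prod.mk.injEq, Sum.inl.injEq,
        reduceCtorEq, and_false, false_and] at h
    · rw [SimpleGraph.Dart.ext d d' (Prod.ext h.1 h.2)]
    · rw [hR.eq_of_mk_eq h.1 (Sum.inr_injective h.2)]
    · rw [hR.eq_of_mk_eq h.2 (Sum.inr_injective h.1)]
  · rintro ⟨⟨u | f, v | g⟩, h⟩
    · exact ⟨.inl ⟨(u, v), h⟩, rfl⟩
    · obtain ⟨d, rfl, rfl⟩ := h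
      exact ⟨.inr (.inl d), rfl⟩
    · obtain ⟨d, rfl, rfl⟩ := h
      exact ⟨.inr (.inr d), rfl⟩
    · exact h.elim

/-- The bijective form of `stellationDart`. -/
noncomputable def FacesSimple.stellationDartEquiv (hR : R.FacesSimple) :
    H.Dart ⊕ H.Dart ⊕ H.Dart ≃ R.stellation.Dart :=
  Equiv.ofBijective _ hR.bijective_stellationDart

theorem mk_facePerm (d : H.Dart) :
    (Quotient.mk _ (R.facePerm d) : R.Face) = Quotient.mk _ d :=
  Quotient.sound (sameCycle_apply_self R.facePerm d).symm

theorem mk_facePerm_symm (d : H.Dart) :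
    (Quotient.mk _ (R.facePerm.symm d) : R.Face) = Quotient.mk _ d := by
  conv_rhs => rw [← R.facePerm.apply_symm_apply d, mk_facePerm]

theorem facePerm_symm_snd (d : H.Dart) : (R.facePerm.symm d).snd = d.fst := by
  rw [← facePerm_fst, Equiv.apply_symm_apply]

theorem next_symm_fst (d : H.Dart) : (R.next.symm d).fst = d.fst := by
  rw [← R.next_fst, Equiv.apply_symm_apply]

theorem facePerm_symm_next (d : H.Dart) : R.facePerm.symm (R.next d) = d.symm := by
  rw [Equiv.symm_apply_eq, facePerm_apply, SimpleGraph.Dart.symm_symm]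

theorem stellationDart_next_fst (x : H.Dart ⊕ H.Dart ⊕ H.Dart) :
    (R.stellationDart (R.stellationNext x)).fst = (R.stellationDart x).fst := by
  rcases x with d | d | d
  · exact congrArg Sum.inl (R.next_fst d)
  · rfl
  · exact congrArg Sum.inr (mk_facePerm_symm d)

theorem stellation_connected (hc : H.Connected) : R.stellation.Connected := by
  have hV : ∀ u v, R.stellation.Reachable (.inl u) (.inl v) := fun u v =>
    (hc.preconnected u v).map ⟨Sum.inl, fun h => h⟩
  have hF : ∀ x : V ⊕ R.Face, ∃ u, R.stellation.Reachable x (.inl u) := by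
    rintro (u | f)
    · exact ⟨u, .refl _⟩
    obtain ⟨d, rfl⟩ := Quotient.exists_rep f
    · exact ⟨d.fst, SimpleGraph.Adj.reachable (G := R.stellation) ⟨d, rfl, rfl⟩⟩
  have := hc.nonempty.map (Sum.inl : V → V ⊕ R.Face)
  refine ⟨fun x y => ?_⟩
  obtain ⟨u, hu⟩ := hF x
  obtain ⟨v, hv⟩ := hF y
  exact hu.trans ((hV u v).trans hv.symm)

variable [Finite V]

instance : Finite R.Face := inferInstanceAs (Finite (Quotient _))

theorem sameCycle_stellationNext {x y : H.Dart ⊕ H.Dart ⊕ H.Dart}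
    (h : (R.stellationDart x).fst = (R.stellationDart y).fst) :
    R.stellationNext.SameCycle x y := by
  have hB : ∀ d, R.stellationNext.SameCycle (.inr (.inl d)) (.inl d) := fun d =>
    sameCycle_apply_self R.stellationNext (.inr (.inl d))
  have hAA : ∀ d d' : H.Dart, d.fst = d'.fst →
      R.stellationNext.SameCycle (.inl d) (.inl d') := fun d d' e =>
    SameCycle.map (f := R.next) (φ := Sum.inl)
      (fun z => (sameCycle_apply_self R.stellationNext (.inl z)).trans (hB _))
      (R.sameCycle d d' e)
  have hCC : ∀ d d' : H.Dart, R.facePerm.SameCycle d d' →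
      R.stellationNext.SameCycle (.inr (.inr d)) (.inr (.inr d')) := fun d d' e =>
    SameCycle.map (f := R.facePerm) (φ := fun z => Sum.inr (Sum.inr z))
      (fun z => SameCycle.symm ⟨1, by simp [stellationNext]⟩) e
  rcases x with d | d | d <;> rcases y with d' | d' | d'
  · exact hAA _ _ (Sum.inl_injective h)
  · exact (hAA _ _ (Sum.inl_injective h)).trans (hB _).symm
  · cases h
  · exact (hB _).trans (hAA _ _ (Sum.inl_injective h))
  · exact (hB _).trans ((hAA _ _ (Sum.inl_injective h)).trans (hB _).symm)
  · cases h
  · cases h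
  · cases h
  · exact hCC _ _ (Quotient.exact (Sum.inr_injective h))

/-- The rotation system of the stellation. -/
noncomputable def FacesSimple.stellationRotation (hR : R.FacesSimple) :
    RotationSystem R.stellation where
  next := hR.stellationDartEquiv.permCongr R.stellationNext
  next_fst d := by
    obtain ⟨x, rfl⟩ := hR.stellationDartEquiv.surjective d
    rw [Equiv.permCongr_apply, Equiv.symm_apply_apply]
    exact stellationDart_next_fst x
  sameCycle d d' h := by
    obtain ⟨x, rfl⟩ := hR.stellationDartEquiv.surjective d
    obtain ⟨y, rfl⟩ := hR.stellationDartEquiv.surjective d'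
    refine SameCycle.map (f := R.stellationNext) (fun z => ⟨1, ?_⟩) (sameCycle_stellationNext h)
    rw [zpow_one, Equiv.permCongr_apply, Equiv.symm_apply_apply]

theorem FacesSimple.stellationRotation_facePerm (hR : R.FacesSimple)
    {x y : H.Dart ⊕ H.Dart ⊕ H.Dart} (h : R.stellationDart y = (R.stellationDart x).symm) :
    hR.stellationRotation.facePerm (R.stellationDart x) = R.stellationDart (R.stellationNext y) := by
  rw [facePerm_apply, ← h]
  change hR.stellationDartEquiv.permCongr R.stellationNext (hR.stellationDartEquiv y) = _
  rw [Equiv.permCongr_apply, Equiv.symm_apply_apply]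
  rfl

/-- Each face consists of an old dart `d`, the spoke inwards at the corner `facePerm d`, and the
spoke outwards at the corner `d`. -/
theorem FacesSimple.stellationRotation_faceOf_ncard (hR : R.FacesSimple) (d : R.stellation.Dart) :
    (hR.stellationRotation.faceOf d).ncard = 3 := by
  have hA : ∀ d, hR.stellationRotation.facePerm (R.stellationDart (.inl d)) =
      R.stellationDart (.inr (.inl (R.facePerm d))) := fun d =>
    hR.stellationRotation_facePerm (y := .inl d.symm) rfl
  have hB : ∀ d, hR.stellationRotation.facePerm (R.stellationDart (.inr (.inl d))) =
      R.stellationDart (.inr (.inr (R.facePerm.symm d))) := fun d =>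
    hR.stellationRotation_facePerm (y := .inr (.inr d)) rfl
  have hC : ∀ d, hR.stellationRotation.facePerm (R.stellationDart (.inr (.inr d))) =
      R.stellationDart (.inl d) := fun d =>
    hR.stellationRotation_facePerm (y := .inr (.inl d)) rfl
  refine ncard_setOf_sameCycle_eq_three ?_ ?_
  · intro e
    have := congrArg (fun d : R.stellation.Dart => d.fst) e
    simp only [facePerm_fst] at this
    exact d.adj.ne this.symm
  · obtain ⟨x, rfl⟩ := hR.bijective_stellationDart.2 d
    rcases x with d | d | d
    · rw [hA, hB, hC, Equiv.symm_apply_apply]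
    · rw [hB, hC, hA, Equiv.apply_symm_apply]
    · rw [hC, hA, hB, Equiv.symm_apply_apply]

theorem FacesSimple.isPlanarTriangulation_stellation [Nontrivial V] (hR : R.FacesSimple)
    (hc : H.Connected) (hp : R.IsPlanar) : R.stellation.IsPlanarTriangulation := by
  have hconn := stellation_connected (R := R) hc
  have h3 := hR.stellationRotation_faceOf_ncard
  have hF : 0 < Nat.card R.Face := by
    have ⟨d, _⟩ := hc.exists_dart_fst_eq (Classical.arbitrary V)
    have : Nonempty R.Face := ⟨Quotient.mk _ d⟩
    exact Nat.card_pos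
  have hV : 1 < Nat.card V := Finite.one_lt_card
  have hW : Nat.card (V ⊕ R.Face) = Nat.card V + Nat.card R.Face := Nat.card_sum
  have : Nontrivial (V ⊕ R.Face) := Sum.inl_injective.nontrivial
  refine ⟨by omega, hconn, hR.stellationRotation, ?_, h3⟩
  rw [isPlanar_iff_of_connected _ hconn]
  have e1 := (isPlanar_iff_of_connected R hc).1 hp
  have e2 := mul_numCycles_eq_natCard h3
  have e3 := Nat.card_congr hR.stellationDartEquiv
  rw [Nat.card_sum, Nat.card_sum] at e3
  have e4 := SimpleGraph.natCard_dart_eq_two_mul H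
  have e5 := SimpleGraph.natCard_dart_eq_two_mul R.stellation
  change Nat.card V + Nat.card R.Face = _ at e1
  -- The stellation has `V + F` vertices, `3E` edges and `2E` faces.
  omega

end RotationSystem

/-! ### The Eulerian orientation of the stellation -/

namespace Digraph

variable {V : Type*} {D : Digraph V}

theorem toSimpleGraphInclusive_adj_iff (hD : D.IsOriented) {u v : V} :
    D.toSimpleGraphInclusive.Adj u v ↔ D.Adj u v ∨ D.Adj v u := by
  rw [toSimpleGraphInclusive, SimpleGraph.fromRel_adj, and_iff_right_iff_imp]
  rintro h rfl
  exact hD.1 u (or_self_iff.1 h)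

theorem IsOriented.adj_swap_iff_not (hD : D.IsOriented) {u v : V}
    (h : D.toSimpleGraphInclusive.Adj u v) : D.Adj v u ↔ ¬ D.Adj u v :=
  ⟨hD.2 v u, fun hn => ((toSimpleGraphInclusive_adj_iff hD).1 h).resolve_left hn⟩

end Digraph

namespace RotationSystem

open Equiv.Perm

variable {V : Type*} {D : Digraph V} (R : RotationSystem D.toSimpleGraphInclusive)
  (c : D.toSimpleGraphInclusive.Coloring (Fin 2))

/-- Every edge of the stellation lies in exactly one triangle whose old edge is traversed from
colour `0` to colour `1`. Orienting each of these triangles cyclically, in accordance with its old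
edge, the spoke at the corner `d` points towards the new vertex exactly if this holds. -/
def SpokeOut (d : D.toSimpleGraphInclusive.Dart) : Prop :=
  if c d.fst = 0 then D.Adj d.snd d.fst else D.Adj (R.facePerm.symm d).fst d.fst

/-- The Eulerian orientation of the stellation. -/
def stellationDigraph : Digraph (V ⊕ R.Face) where
  Adj
    | .inl u, .inl v => D.Adj u v
    | .inl u, .inr f => ∃ d, d.fst = u ∧ Quotient.mk _ d = f ∧ R.SpokeOut c d
    | .inr f, .inl u => ∃ d, d.fst = u ∧ Quotient.mk _ d = f ∧ ¬ R.SpokeOut c d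
    | .inr _, .inr _ => False

/-- The darts of the stellation that are directed along its Eulerian orientation. -/
def StellationOut : D.toSimpleGraphInclusive.Dart ⊕ D.toSimpleGraphInclusive.Dart ⊕
    D.toSimpleGraphInclusive.Dart → Prop
  | .inl d => D.Adj d.fst d.snd
  | .inr (.inl d) => R.SpokeOut c d
  | .inr (.inr d) => ¬ R.SpokeOut c d

/-- The involution pairing the two darts of a coherently oriented triangle that leave the same
vertex. -/
def stellationSwap : D.toSimpleGraphInclusive.Dart ⊕ D.toSimpleGraphInclusive.Dart ⊕
    D.toSimpleGraphInclusive.Dart → D.toSimpleGraphInclusive.Dart ⊕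
    D.toSimpleGraphInclusive.Dart ⊕ D.toSimpleGraphInclusive.Dart
  | .inl d => if c d.fst = 0 then .inr (.inl d) else .inr (.inl (R.next d))
  | .inr (.inl d) => if c d.fst = 0 then .inl d else .inl (R.next.symm d)
  | .inr (.inr d) =>
    if c d.fst = 0 then .inr (.inr (R.facePerm d)) else .inr (.inr (R.facePerm.symm d))

variable {R c}

theorem color_fst_eq_zero_iff (d : D.toSimpleGraphInclusive.Dart) :
    c d.fst = 0 ↔ ¬ c d.snd = 0 := by
  have := c.valid d.adj
  omega

theorem color_facePerm_symm_fst (d : D.toSimpleGraphInclusive.Dart) :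
    c (R.facePerm.symm d).fst = 0 ↔ ¬ c d.fst = 0 := by
  rw [color_fst_eq_zero_iff, facePerm_symm_snd]

theorem stellationSwap_involutive : Function.Involutive (R.stellationSwap c) := by
  rintro (d | d | d) <;> by_cases h : c d.fst = 0
  · simp [stellationSwap, h]
  · simp [stellationSwap, h, R.next_fst]
  · simp [stellationSwap, h]
  · simp [stellationSwap, h, next_symm_fst]
  · have h1 : ¬ c (R.facePerm d).fst = 0 := by
      rwa [facePerm_fst, ← color_fst_eq_zero_iff]
    simp [stellationSwap, h, h1]
  · have h1 := (color_facePerm_symm_fst (R := R) d).2 h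
    simp [stellationSwap, h, h1]

theorem stellationDart_stellationSwap_fst (x) :
    (R.stellationDart (R.stellationSwap c x)).fst = (R.stellationDart x).fst := by
  rcases x with d | d | d <;> by_cases h : c d.fst = 0 <;>
    simp [stellationSwap, h, stellationDart, R.next_fst, next_symm_fst, mk_facePerm,
      mk_facePerm_symm]

theorem stellationOut_stellationSwap (hD : D.IsOriented) (x) :
    R.StellationOut c (R.stellationSwap c x) ↔ ¬ R.StellationOut c x := by
  have hA : ∀ d, R.StellationOut c (R.stellationSwap c (.inl d)) ↔
      ¬ R.StellationOut c (.inl d) := by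
    intro d
    by_cases h : c d.fst = 0
    · simp [stellationSwap, h, StellationOut, SpokeOut, hD.adj_swap_iff_not d.adj]
    · simp [stellationSwap, h, StellationOut, SpokeOut, R.next_fst, facePerm_symm_next,
        hD.adj_swap_iff_not d.adj]
  have hC : ∀ d, c d.fst = 0 → (R.StellationOut c (R.stellationSwap c (.inr (.inr d))) ↔
      ¬ R.StellationOut c (.inr (.inr d))) := by
    intro d h
    have h1 : ¬ c d.snd = 0 := (color_fst_eq_zero_iff d).1 h
    simp [stellationSwap, h, h1, StellationOut, SpokeOut, facePerm_fst,
      hD.adj_swap_iff_not d.adj]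
  -- The swap is an involution, so the claim for one dart gives it for its partner.
  have key : ∀ x y, R.stellationSwap c x = y →
      (R.StellationOut c (R.stellationSwap c x) ↔ ¬ R.StellationOut c x) →
      (R.StellationOut c (R.stellationSwap c y) ↔ ¬ R.StellationOut c y) := by
    rintro x y rfl h
    rw [stellationSwap_involutive x, h, not_not]
  rcases x with d | d | d
  · exact hA d
  · by_cases h : c d.fst = 0
    · exact key (.inl d) _ (by simp [stellationSwap, h]) (hA d)
    · exact key (.inl (R.next.symm d)) _ (by simp [stellationSwap, h, next_symm_fst]) (hA _)
  · by_cases h : c d.fst = 0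
    · exact hC d h
    · have h1 := (color_facePerm_symm_fst (R := R) d).2 h
      exact key (.inr (.inr (R.facePerm.symm d))) _ (by simp [stellationSwap, h1]) (hC _ h1)

theorem FacesSimple.isOriented_stellationDigraph (hR : R.FacesSimple) (hD : D.IsOriented) :
    (R.stellationDigraph c).IsOriented := by
  constructor
  · rintro (u | f) h
    · exact hD.1 u h
    · exact h
  · rintro (u | f) (v | g) h h'
    · exact hD.2 u v h h'
    · obtain ⟨d, rfl, rfl, h⟩ := h
      obtain ⟨d', e, e', h'⟩ := h'
      exact h' (hR.eq_of_mk_eq e e' ▸ h)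
    · obtain ⟨d, rfl, rfl, h⟩ := h
      obtain ⟨d', e, e', h'⟩ := h'
      exact h (hR.eq_of_mk_eq e e' ▸ h')
    · exact h

theorem stellationDigraph_toSimpleGraphInclusive (hD : D.IsOriented) (hR : R.FacesSimple) :
    (R.stellationDigraph c).toSimpleGraphInclusive = R.stellation := by
  ext x y
  rw [Digraph.toSimpleGraphInclusive_adj_iff (hR.isOriented_stellationDigraph hD)]
  have h : ∀ u f, ((∃ d, d.fst = u ∧ Quotient.mk _ d = f ∧ R.SpokeOut c d) ∨
      (∃ d, d.fst = u ∧ Quotient.mk _ d = f ∧ ¬ R.SpokeOut c d)) ↔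
      ∃ d : D.toSimpleGraphInclusive.Dart, d.fst = u ∧ (Quotient.mk _ d : R.Face) = f := by
    intro u f
    rw [← exists_or]
    refine exists_congr fun d => ?_
    tauto
  rcases x with u | f <;> rcases y with v | g
  · exact (Digraph.toSimpleGraphInclusive_adj_iff hD).symm
  · exact h u g
  · exact or_comm.trans (h v f)
  · exact or_self_iff

theorem FacesSimple.stellationDigraph_adj_iff (hR : R.FacesSimple) (x) :
    (R.stellationDigraph c).Adj (R.stellationDart x).fst (R.stellationDart x).snd ↔
      R.StellationOut c x := by
  rcases x with d | d | d
  · rfl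
  · refine ⟨fun ⟨d', e, e', h⟩ => ?_, fun h => ⟨d, rfl, rfl, h⟩⟩
    exact hR.eq_of_mk_eq e e' ▸ h
  · refine ⟨fun ⟨d', e, e', h⟩ => ?_, fun h => ⟨d, rfl, rfl, h⟩⟩
    exact hR.eq_of_mk_eq e e' ▸ h

/-- Neighbours are counted by darts at `v`, and `stellationSwap` exchanges the outgoing with the
incoming ones. -/
theorem FacesSimple.ncard_out_eq_ncard_in (hR : R.FacesSimple) (hD : D.IsOriented)
    (v : V ⊕ R.Face) :
    {w | (R.stellationDigraph c).Adj v w}.ncard = {w | (R.stellationDigraph c).Adj w v}.ncard := by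
  have hor := hR.isOriented_stellationDigraph (c := c) hD
  have hG := stellationDigraph_toSimpleGraphInclusive (c := c) hD hR
  have hinj : ∀ s : Set _, (∀ x ∈ s, (R.stellationDart x).fst = v) →
      Set.InjOn (fun x => (R.stellationDart x).snd) s := fun s hs x hx y hy e =>
    hR.bijective_stellationDart.1
      (SimpleGraph.Dart.ext _ _ (Prod.ext ((hs x hx).trans (hs y hy).symm) e))
  have hout : {w | (R.stellationDigraph c).Adj v w} =
      (fun x => (R.stellationDart x).snd) ''
        {x | (R.stellationDart x).fst = v ∧ R.StellationOut c x} := by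
    ext w
    constructor
    · intro h
      have hadj : R.stellation.Adj v w := by
        rw [← hG, Digraph.toSimpleGraphInclusive_adj_iff hor]
        exact .inl h
      obtain ⟨x, hx⟩ := hR.bijective_stellationDart.2 ⟨(v, w), hadj⟩
      refine ⟨x, ⟨by rw [hx], ?_⟩, by simp only [hx]⟩
      rw [← hR.stellationDigraph_adj_iff, hx]
      exact h
    · rintro ⟨x, ⟨rfl, h⟩, rfl⟩
      exact hR.stellationDigraph_adj_iff x |>.2 h
  have hin : {w | (R.stellationDigraph c).Adj w v} =
      (fun x => (R.stellationDart x).snd) ''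
        {x | (R.stellationDart x).fst = v ∧ ¬ R.StellationOut c x} := by
    ext w
    constructor
    · intro h
      have hadj : R.stellation.Adj v w := by
        rw [← hG, Digraph.toSimpleGraphInclusive_adj_iff hor]
        exact .inr h
      obtain ⟨x, hx⟩ := hR.bijective_stellationDart.2 ⟨(v, w), hadj⟩
      refine ⟨x, ⟨by rw [hx], ?_⟩, by simp only [hx]⟩
      rw [← hR.stellationDigraph_adj_iff, hx]
      exact hor.2 _ _ h
    · rintro ⟨x, ⟨rfl, h⟩, rfl⟩
      rw [← hR.stellationDigraph_adj_iff] at h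
      refine (hor.adj_swap_iff_not ?_).2 h
      rw [hG]
      exact (R.stellationDart x).adj
  rw [hout, hin, (hinj _ fun x hx => hx.1).ncard_image,
    (hinj _ fun x hx => hx.1).ncard_image,
    ← Set.ncard_image_of_injective _ (stellationSwap_involutive (R := R) (c := c)).injective]
  congr 1
  ext x
  rw [(stellationSwap_involutive (R := R) (c := c)).image_eq_preimage_symm]
  simp [stellationDart_stellationSwap_fst, stellationOut_stellationSwap hD]

end RotationSystem

namespace Digraph

theorem isInducedByTwoParts_of_isPlanarGraph {V : Type u} [Finite V] {D : Digraph V}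
    (hD : D.IsOriented) (h2 : D.toSimpleGraphInclusive.IsTwoVertexConnected)
    (hb : D.toSimpleGraphInclusive.IsBipartite) (hp : D.toSimpleGraphInclusive.IsPlanarGraph) :
    D.IsInducedByTwoParts := by
  obtain ⟨hcard, hc, hcut⟩ := h2
  obtain ⟨c⟩ := hb
  obtain ⟨R, hRp⟩ := hp
  have : Nontrivial V := Finite.one_lt_card_iff_nontrivial.1 hcard
  have hR : R.FacesSimple := fun d d' => hRp.eq_of_sameCycle_facePerm hc hcut
  have hG := RotationSystem.stellationDigraph_toSimpleGraphInclusive (c := c) hD hR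
  have hT := hR.isPlanarTriangulation_stellation hc hRp
  let C : (R.stellationDigraph c).toSimpleGraphInclusive.Coloring (Fin 3) :=
    SimpleGraph.Coloring.mk (Sum.elim (fun u => (c u).castSucc) fun _ => 2) (by
      rw [hG]
      rintro (u | f) (v | g) h
      · exact fun e => c.valid h (Fin.castSucc_injective _ e)
      · exact (Fin.castSucc_lt_last (c u)).ne
      · exact (Fin.castSucc_lt_last (c v)).ne'
      · exact h.elim)
  refine ⟨V ⊕ R.Face, inferInstance, R.stellationDigraph c, C, 2, hG ▸ hT,
    ⟨hR.isOriented_stellationDigraph hD, hG ▸ hT.2.1, hR.ncard_out_eq_ncard_in hD⟩, ⟨?_⟩⟩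
  refine ⟨Equiv.ofBijective (fun u => ⟨.inl u, ?_⟩) ⟨?_, ?_⟩, Iff.rfl⟩
  · exact (Fin.castSucc_lt_last (c u)).ne
  · intro u v e
    exact Sum.inl_injective (congrArg Subtype.val e)
  · rintro ⟨u | f, h⟩
    · exact ⟨u, rfl⟩
    · exact absurd rfl h

end Digraph

/-! ### Embedded darts, and connectivity after deleting independent vertices -/

namespace SimpleGraph

variable {V W : Type*} {H : SimpleGraph V} {G : SimpleGraph W}

/-- The image of a dart under a graph embedding. -/
def Embedding.dart (f : H ↪g G) (d : H.Dart) : G.Dart :=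
  ⟨(f d.fst, f d.snd), f.map_rel_iff.2 d.adj⟩

theorem Embedding.dart_injective (f : H ↪g G) : Function.Injective f.dart := fun _ _ h =>
  Dart.ext _ _ (Prod.ext (f.injective congr(($h).fst)) (f.injective congr(($h).snd)))

theorem Embedding.exists_dart_eq (f : H ↪g G) {d : G.Dart} (h1 : d.fst ∈ Set.range f)
    (h2 : d.snd ∈ Set.range f) : ∃ d', f.dart d' = d := by
  obtain ⟨a, ha⟩ := h1
  obtain ⟨b, hb⟩ := h2
  refine ⟨⟨(a, b), f.map_rel_iff.1 (ha ▸ hb ▸ d.adj)⟩, Dart.ext _ _ (Prod.ext ha hb)⟩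

/-- Deleting an independent set of vertices keeps a graph connected if the neighbours of each
deleted vertex remain connected to each other. -/
theorem Preconnected.of_embedding (f : H ↪g G) (hG : G.Preconnected)
    (hind : ∀ w w', w ∉ Set.range f → w' ∉ Set.range f → ¬ G.Adj w w')
    (hnb : ∀ w, w ∉ Set.range f → ∀ a b, G.Adj w (f a) → G.Adj w (f b) → H.Reachable a b) :
    H.Preconnected := by
  intro a b
  obtain ⟨p⟩ := hG (f a) (f b)
  -- For a walk starting at a deleted vertex, the induction needs the claim for every kept neighbour
  -- of that vertex.
  suffices ∀ x y, G.Walk x y → y = f b → (∀ a, x = f a → H.Reachable a b) ∧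
      (x ∉ Set.range f → ∀ a, G.Adj x (f a) → H.Reachable a b) from (this _ _ p rfl).1 a rfl
  intro x y p
  induction p with
  | nil =>
    rintro rfl
    exact ⟨fun a h => f.injective h ▸ Reachable.refl _, fun h => (h ⟨b, rfl⟩).elim⟩
  | @cons x z y hxz p ih =>
    intro hy
    obtain ⟨ih1, ih2⟩ := ih hy
    by_cases hz : z ∈ Set.range f
    · obtain ⟨a', rfl⟩ := hz
      refine ⟨?_, fun hx a ha => (hnb x hx a a' ha hxz).trans (ih1 a' rfl)⟩
      rintro a rfl
      exact (f.map_rel_iff.1 hxz).reachable.trans (ih1 a' rfl)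
    · refine ⟨?_, fun hx => (hind x z hx hz hxz).elim⟩
      rintro a rfl
      exact ih2 hz a hxz.symm

end SimpleGraph

/-! ### Two colour classes of a 3-coloured triangulation -/

namespace RotationSystem

open Equiv.Perm

section Triangular

variable {W : Type*} {G : SimpleGraph W} {R : RotationSystem G}

theorem facePerm_facePerm_facePerm [Finite W] (h3 : ∀ d : G.Dart, (R.faceOf d).ncard = 3)
    (d : G.Dart) : R.facePerm (R.facePerm (R.facePerm d)) = d := by
  classical
  have := Fintype.ofFinite G.Dart
  have hne : R.facePerm d ≠ d := fun e => d.adj.ne (by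
    conv_lhs => rw [← e]
    exact R.facePerm_fst d |>.symm ▸ rfl)
  have hcard : (R.facePerm.cycleOf d).support.card = 3 := by
    rw [← h3 d, ← Set.ncard_coe_finset]
    congr 1
    ext y
    simpa [faceOf] using mem_support_cycleOf_iff' (y := y) hne
  have := pow_mod_card_support_cycleOf_self_apply R.facePerm 3 d
  rw [hcard] at this
  exact this.symm

theorem facePerm_facePerm_snd (h3 : ∀ d : G.Dart, R.facePerm (R.facePerm (R.facePerm d)) = d)
    (d : G.Dart) : (R.facePerm (R.facePerm d)).snd = d.fst := by
  rw [← facePerm_fst, h3]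

theorem adj_snd_facePerm_snd (h3 : ∀ d : G.Dart, R.facePerm (R.facePerm (R.facePerm d)) = d)
    (d : G.Dart) : G.Adj (R.facePerm d).snd d.fst := by
  rw [← facePerm_facePerm_snd h3 d, ← facePerm_fst]
  exact SimpleGraph.Dart.adj _

theorem adj_next_snd_snd (h3 : ∀ d : G.Dart, R.facePerm (R.facePerm (R.facePerm d)) = d)
    (d : G.Dart) : G.Adj (R.next d).snd d.snd := by
  have := adj_snd_facePerm_snd h3 d.symm
  rwa [facePerm_apply, SimpleGraph.Dart.symm_symm] at this

end Triangular

section TwoParts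

variable {V W : Type*} {H : SimpleGraph V} {G : SimpleGraph W} {R : RotationSystem G}
  {C : G.Coloring (Fin 3)} {i : Fin 3} {f : H ↪g G}

theorem color_apply_ne (hf : ∀ w, w ∈ Set.range f ↔ C w ≠ i) (v : V) : C (f v) ≠ i :=
  (hf _).1 ⟨v, rfl⟩

/-- Successive neighbours of a vertex span a triangle with it, and a triangle has all three colours.
-/
theorem color_next_snd (h3 : ∀ d : G.Dart, R.facePerm (R.facePerm (R.facePerm d)) = d)
    {d : G.Dart} (h1 : C d.fst ≠ i) (h2 : C d.snd ≠ i) :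
    C (R.next d).snd = i := by
  have e1 := C.valid (adj_next_snd_snd h3 d)
  have e2 := C.valid (R.next d).adj
  have e3 := C.valid d.adj
  rw [R.next_fst] at e2
  omega

theorem exists_dart_eq_next_next (h3 : ∀ d : G.Dart, R.facePerm (R.facePerm (R.facePerm d)) = d)
    (hf : ∀ w, w ∈ Set.range f ↔ C w ≠ i) (d : H.Dart) :
    ∃ d', f.dart d' = R.next (R.next (f.dart d)) := by
  have e1 := color_next_snd h3 (d := f.dart d) (color_apply_ne hf _) (color_apply_ne hf _)
  have e2 := C.valid (adj_next_snd_snd h3 (R.next (f.dart d)))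
  refine f.exists_dart_eq ((hf _).2 ?_) ((hf _).2 (e1 ▸ e2))
  rw [R.next_fst, R.next_fst]
  exact color_apply_ne hf _

/-- The rotation system induced on two of the three parts: every second dart is kept. -/
noncomputable def twoParts [Finite V] [Finite W]
    (h3 : ∀ d : G.Dart, R.facePerm (R.facePerm (R.facePerm d)) = d)
    (hf : ∀ w, w ∈ Set.range f ↔ C w ≠ i) : RotationSystem H where
  next := Equiv.ofBijective (fun d => (exists_dart_eq_next_next h3 hf d).choose) <|
    Finite.injective_iff_bijective.1 fun d d' e => f.dart_injective <|
      R.next.injective <| R.next.injective <| by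
        rw [← (exists_dart_eq_next_next h3 hf d).choose_spec,
          ← (exists_dart_eq_next_next h3 hf d').choose_spec]
        exact congrArg f.dart e
  next_fst d := by
    apply f.injective
    have e := congrArg (fun d : G.Dart => d.fst) (exists_dart_eq_next_next h3 hf d).choose_spec
    simp only [R.next_fst] at e
    exact e
  sameCycle d d' h := by
    obtain ⟨n, hn⟩ := SameCycle.exists_nat_pow_eq
      (R.sameCycle (f.dart d) (f.dart d') (congrArg f h))
    clear h
    induction n using Nat.strong_induction_on generalizing d with
    | _ n ih =>
      match n with
      | 0 => exact (f.dart_injective hn).sameCycle _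
      -- An odd number of turns would end at a vertex of the deleted colour.
      | 1 =>
        have := color_next_snd h3 (d := f.dart d) (color_apply_ne hf _) (color_apply_ne hf _)
        rw [pow_one] at hn
        rw [hn] at this
        exact (color_apply_ne hf _ this).elim
      | n + 2 =>
        rw [pow_add, mul_apply, pow_two, mul_apply,
          ← (exists_dart_eq_next_next h3 hf d).choose_spec] at hn
        exact (SameCycle.trans ⟨1, by rw [zpow_one]; rfl⟩ (ih n (by omega) _ hn))

theorem dart_twoParts_next [Finite V] [Finite W]
    (h3 : ∀ d : G.Dart, R.facePerm (R.facePerm (R.facePerm d)) = d)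
    (hf : ∀ w, w ∈ Set.range f ↔ C w ≠ i) (d : H.Dart) :
    f.dart ((twoParts h3 hf).next d) = R.next (R.next (f.dart d)) :=
  (exists_dart_eq_next_next h3 hf d).choose_spec

theorem dart_twoParts_facePerm [Finite V] [Finite W]
    (h3 : ∀ d : G.Dart, R.facePerm (R.facePerm (R.facePerm d)) = d)
    (hf : ∀ w, w ∈ Set.range f ↔ C w ≠ i) (d : H.Dart) :
    f.dart ((twoParts h3 hf).facePerm d) = R.next (R.facePerm (f.dart d)) := by
  rw [facePerm_apply, dart_twoParts_next]
  rfl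

theorem color_facePerm_snd (h3 : ∀ d : G.Dart, R.facePerm (R.facePerm (R.facePerm d)) = d)
    (hf : ∀ w, w ∈ Set.range f ↔ C w ≠ i) (d : H.Dart) : C (R.facePerm (f.dart d)).snd = i := by
  have e1 := C.valid (adj_snd_facePerm_snd h3 (f.dart d))
  have e2 := C.valid (R.facePerm (f.dart d)).adj
  rw [facePerm_fst] at e2
  have e3 := C.valid (f.dart d).adj
  have e4 := color_apply_ne hf d.fst
  have e5 := color_apply_ne hf d.snd
  change C (f d.fst) ≠ C (f d.snd) at e3
  change _ ≠ C (f d.fst) at e1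
  change C (f d.snd) ≠ _ at e2
  omega

theorem exists_facePerm_facePerm_dart_eq
    (h3 : ∀ d : G.Dart, R.facePerm (R.facePerm (R.facePerm d)) = d)
    (hf : ∀ w, w ∈ Set.range f ↔ C w ≠ i) {x : G.Dart} (hx : C x.fst = i) :
    ∃ d : H.Dart, R.facePerm (R.facePerm (f.dart d)) = x := by
  have e1 := C.valid x.adj
  have e2 := C.valid (R.facePerm x).adj
  have e3 := C.valid (adj_snd_facePerm_snd h3 x)
  rw [facePerm_fst] at e2
  obtain ⟨d, hd⟩ := f.exists_dart_eq (d := R.facePerm x)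
    ((hf _).2 (by rw [facePerm_fst]; omega)) ((hf _).2 (by omega))
  exact ⟨d, by rw [hd, h3]⟩

/-- Each facial triangle has exactly one dart avoiding the deleted colour, namely a dart of `H`. -/
theorem natCard_dart_eq_three_mul [Finite V] [Finite W]
    (h3 : ∀ d : G.Dart, R.facePerm (R.facePerm (R.facePerm d)) = d)
    (hf : ∀ w, w ∈ Set.range f ↔ C w ≠ i) : Nat.card G.Dart = 3 * Nat.card H.Dart := by
  let t : H.Dart ⊕ H.Dart ⊕ H.Dart → G.Dart := fun
    | .inl d => f.dart d
    | .inr (.inl d) => R.facePerm (f.dart d)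
    | .inr (.inr d) => R.facePerm (R.facePerm (f.dart d))
  have hA (d : H.Dart) : C (f.dart d).fst ≠ i := color_apply_ne hf _
  have hA' (d : H.Dart) : C (f.dart d).snd ≠ i := color_apply_ne hf _
  have hB (d : H.Dart) : C (R.facePerm (f.dart d)).fst ≠ i := by
    rw [facePerm_fst]; exact hA' d
  have hB' (d : H.Dart) : C (R.facePerm (f.dart d)).snd = i := color_facePerm_snd h3 hf d
  have hC (d : H.Dart) : C (R.facePerm (R.facePerm (f.dart d))).fst = i := by
    rw [facePerm_fst]; exact hB' d
  have ht : Function.Bijective t := by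
    constructor
    · rintro (d | d | d) (d' | d' | d') h <;> simp only [t] at h
      · rw [f.dart_injective h]
      · exact (hA' d (h ▸ hB' d')).elim
      · exact (hA d (h ▸ hC d')).elim
      · exact (hA' d' (h ▸ hB' d)).elim
      · rw [f.dart_injective (R.facePerm.injective h)]
      · exact (hB d (h ▸ hC d')).elim
      · exact (hA d' (h ▸ hC d)).elim
      · exact (hB d' (h ▸ hC d)).elim
      · rw [f.dart_injective (R.facePerm.injective (R.facePerm.injective h))]
    · intro x
      by_cases h1 : C x.fst = i
      · obtain ⟨d, hd⟩ := exists_facePerm_facePerm_dart_eq h3 hf h1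
        exact ⟨.inr (.inr d), hd⟩
      by_cases h2 : C x.snd = i
      · obtain ⟨d, hd⟩ := exists_facePerm_facePerm_dart_eq h3 hf
          (x := R.facePerm x) (by rwa [facePerm_fst])
        exact ⟨.inr (.inl d), R.facePerm.injective hd⟩
      · obtain ⟨d, hd⟩ := f.exists_dart_eq ((hf _).2 h1) ((hf _).2 h2)
        exact ⟨.inl d, hd⟩
  rw [← Nat.card_congr (Equiv.ofBijective t ht), Nat.card_sum, Nat.card_sum]
  omega

/-- The dart `R.facePerm (R.facePerm (f.dart d))` leaves the deleted vertex of the triangle at `d`.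
Advancing along a face of `H` turns it backwards around that vertex, whence faces match deleted
vertices. -/
theorem next_facePerm_facePerm_dart [Finite V] [Finite W]
    (h3 : ∀ d : G.Dart, R.facePerm (R.facePerm (R.facePerm d)) = d)
    (hf : ∀ w, w ∈ Set.range f ↔ C w ≠ i) (d : H.Dart) :
    R.next (R.facePerm (R.facePerm (f.dart ((twoParts h3 hf).facePerm d)))) =
      R.facePerm (R.facePerm (f.dart d)) := by
  have (y : G.Dart) : R.next y = R.facePerm y.symm := by
    rw [facePerm_apply, SimpleGraph.Dart.symm_symm]
  rw [dart_twoParts_facePerm, this (R.facePerm (f.dart d)), h3]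
  rfl

/-- The faces of the subgraph induced by two parts correspond to the vertices of the third. -/
theorem numCycles_twoParts_facePerm [Finite V] [Finite W]
    (h3 : ∀ d : G.Dart, R.facePerm (R.facePerm (R.facePerm d)) = d)
    (hf : ∀ w, w ∈ Set.range f ↔ C w ≠ i)
    (hd : ∀ w, ∃ d : G.Dart, d.fst = w) :
    (twoParts h3 hf).facePerm.numCycles = Nat.card {w // C w = i} := by
  set φ := (twoParts h3 hf).facePerm with hφ
  let κ : H.Dart → G.Dart := fun d => R.facePerm (R.facePerm (f.dart d))
  have hκ (d : H.Dart) : R.next (κ (φ d)) = κ d := next_facePerm_facePerm_dart h3 hf d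
  have hκ' (d : H.Dart) : R.next (κ d) = κ (φ.symm d) := by
    rw [← hκ (φ.symm d), Equiv.apply_symm_apply]
  have hκi : Function.Injective κ := fun _ _ h =>
    f.dart_injective (R.facePerm.injective (R.facePerm.injective h))
  let q : H.Dart → {w // C w = i} := fun d =>
    ⟨(κ d).fst, by rw [facePerm_fst]; exact color_facePerm_snd h3 hf d⟩
  refine Nat.card_congr (Equiv.ofBijective (Quotient.lift q fun d d' h =>
    (sameCycle_setoid_le_iff (r := Setoid.ker q)).2 (fun x => Subtype.ext ?_) h) ⟨?_, ?_⟩)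
  · change (κ x).fst = (κ (φ x)).fst
    rw [← hκ x, R.next_fst]
  · rintro ⟨d⟩ ⟨d'⟩ e
    refine Quotient.sound ?_
    have e' : (κ d).fst = (κ d').fst := congrArg Subtype.val e
    obtain ⟨n, hn⟩ := SameCycle.exists_nat_pow_eq (R.sameCycle _ _ e')
    clear e e'
    change φ.SameCycle d d'
    induction n generalizing d with
    | zero => exact (hκi hn).sameCycle _
    | succ n ih =>
      rw [pow_succ, mul_apply, hκ'] at hn
      exact sameCycle_symm_apply_left.1 (ih _ hn)
  · rintro ⟨w, rfl⟩
    obtain ⟨x, rfl⟩ := hd w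
    obtain ⟨d, hd⟩ := exists_facePerm_facePerm_dart_eq h3 hf (x := x) rfl
    exact ⟨Quotient.mk _ d, Subtype.ext (congrArg (fun d : G.Dart => d.fst) hd)⟩

theorem preconnected_of_twoParts [Finite W]
    (h3 : ∀ d : G.Dart, R.facePerm (R.facePerm (R.facePerm d)) = d)
    (hf : ∀ w, w ∈ Set.range f ↔ C w ≠ i) (hG : G.Preconnected) : H.Preconnected := by
  refine hG.of_embedding f (fun w w' h h' ha => ?_) fun w hw a b ha hb => ?_
  · rw [hf, not_not] at h h'
    exact C.valid ha (h.trans h'.symm)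
  · rw [hf, not_not] at hw
    obtain ⟨n, hn⟩ := SameCycle.exists_nat_pow_eq
      (R.sameCycle ⟨(w, f a), ha⟩ ⟨(w, f b), hb⟩ rfl)
    suffices ∀ (x : G.Dart) b, C x.fst = i → x.snd = f a → ((R.next ^ n) x).snd = f b →
      H.Reachable a b from this ⟨(w, f a), ha⟩ b hw rfl (by rw [hn])
    clear hn ha hb hw b w
    intro x b hx hxa hxb
    induction n generalizing b with
    | zero => exact f.injective (hxa.symm.trans hxb) ▸ SimpleGraph.Reachable.refl _
    | succ n ih =>
      rw [pow_succ', mul_apply] at hxb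
      have hfst : C ((R.next ^ n) x).fst = i := by
        rw [← R.fst_eq_of_sameCycle (d := x) ⟨n, by rw [zpow_natCast]⟩, hx]
      obtain ⟨c, hc⟩ := (hf ((R.next ^ n) x).snd).2 (hfst ▸ C.valid ((R.next ^ n) x).adj.symm)
      have hadj := adj_next_snd_snd h3 ((R.next ^ n) x)
      rw [hxb, ← hc] at hadj
      exact (ih c hc.symm).trans (f.map_rel_iff.1 hadj).symm.reachable

/-- The neighbours of a deleted vertex are connected to each other around that vertex, avoiding any
one of them. -/
theorem reachable_around [Finite W]
    (h3 : ∀ d : G.Dart, R.facePerm (R.facePerm (R.facePerm d)) = d)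
    (hf : ∀ w, w ∈ Set.range f ↔ C w ≠ i) {w : W} (hw : C w = i) {v : V} (hv : G.Adj w (f v))
    {a b : {u | u ≠ v}} (ha : G.Adj w (f a)) (hb : G.Adj w (f b)) :
    (H.induce {u | u ≠ v}).Reachable a b := by
  set x : G.Dart := ⟨(w, f v), hv⟩ with hx
  have hCx (n : ℕ) : C ((R.next ^ n) x).fst = i := by
    rw [← R.fst_eq_of_sameCycle (d := x) ⟨n, by rw [zpow_natCast]⟩, hx, hw]
  have hrange (n : ℕ) : ∃ u, f u = ((R.next ^ n) x).snd :=
    (hf _).2 (hCx n ▸ C.valid ((R.next ^ n) x).adj.symm)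
  obtain ⟨z, hz⟩ := hrange 1
  have hzv : z ≠ v := by
    rintro rfl
    have := adj_next_snd_snd h3 x
    rw [pow_one] at hz
    rw [← hz] at this
    exact G.irrefl this
  have key : ∀ n (b : {u | u ≠ v}), ((R.next ^ n) x).snd = f b →
      (H.induce {u | u ≠ v}).Reachable ⟨z, hzv⟩ b := by
    intro n
    induction n with
    | zero => exact fun b h => (b.2 (f.injective h.symm)).elim
    | succ n ih =>
      intro b hb
      obtain ⟨c, hc⟩ := hrange n
      -- On a return to `v` the dart is `x` again, so the next neighbour is `z` and the walk
      -- restarts there.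
      by_cases hcv : c = v
      · have hxn : (R.next ^ n) x = x := by
          refine SimpleGraph.Dart.ext _ _ (Prod.ext ?_ (hc.symm.trans (hcv ▸ rfl)))
          exact (R.fst_eq_of_sameCycle (d := x) ⟨n, by rw [zpow_natCast]⟩).symm
        rw [pow_succ', mul_apply, hxn] at hb
        rw [pow_one] at hz
        have : z = b := f.injective (hz.trans hb)
        exact Subtype.ext (a1 := ⟨z, hzv⟩) this ▸ SimpleGraph.Reachable.refl _
      · have hadj := adj_next_snd_snd h3 ((R.next ^ n) x)
        rw [← mul_apply, ← pow_succ', hb, ← hc] at hadj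
        refine (ih ⟨c, hcv⟩ hc.symm).trans (SimpleGraph.Adj.reachable ?_)
        exact (f.map_rel_iff.1 hadj).symm
  have hto : ∀ b : {u | u ≠ v}, G.Adj w (f b) →
      (H.induce {u | u ≠ v}).Reachable ⟨z, hzv⟩ b := by
    intro b hb
    obtain ⟨n, hn⟩ := SameCycle.exists_nat_pow_eq (R.sameCycle x ⟨(w, f b), hb⟩ rfl)
    exact key n b (by rw [hn])
  exact (hto a ha).symm.trans (hto b hb)

/-- Between two successive kept neighbours of `v` lies a deleted vertex adjacent to both. They are
joined by going around it while avoiding `v`, as in `reachable_around`. -/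
theorem not_isCutVertex_of_twoParts [Finite V] [Finite W]
    (h3 : ∀ d : G.Dart, R.facePerm (R.facePerm (R.facePerm d)) = d)
    (hf : ∀ w, w ∈ Set.range f ↔ C w ≠ i) (hG : G.Preconnected) (v : V) : ¬ H.IsCutVertex v := by
  rw [SimpleGraph.IsCutVertex, not_not]
  have hrange : ∀ u, u ∉ Set.range (SimpleGraph.Embedding.induce (G := H) {w | w ≠ v}) → u = v := by
    intro u hu
    by_contra hne
    exact hu ⟨⟨u, hne⟩, rfl⟩
  refine (preconnected_of_twoParts h3 hf hG).of_embedding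
    (SimpleGraph.Embedding.induce (G := H) {w | w ≠ v}) (fun w w' h h' ha => ?_)
    fun w hw a b ha hb => ?_
  · rw [hrange w h, hrange w' h'] at ha
    exact H.irrefl ha
  · obtain rfl := (hrange w hw).symm
    have ha' : H.Adj v a := ha
    have hb' : H.Adj v b := hb
    obtain ⟨n, hn⟩ := SameCycle.exists_nat_pow_eq
      ((twoParts h3 hf).sameCycle ⟨(v, a), ha'⟩ ⟨(v, b), hb'⟩ rfl)
    suffices ∀ (d : H.Dart) (b : {w | w ≠ v}), d.fst = v → d.snd = a →
      (((twoParts h3 hf).next ^ n) d).snd = b → (H.induce {w | w ≠ v}).Reachable a b from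
      this ⟨(v, a), ha'⟩ b rfl rfl (by rw [hn])
    clear hn ha hb ha' hb' b hw
    intro d b hd hda hdb
    induction n generalizing b with
    | zero => exact Subtype.ext (hda.symm.trans hdb) ▸ SimpleGraph.Reachable.refl _
    | succ n ih =>
      set e := ((twoParts h3 hf).next ^ n) d with he
      have hev : e.fst = v := by
        rw [← hd, (twoParts h3 hf).fst_eq_of_sameCycle (d := d) ⟨n, by rw [zpow_natCast]⟩]
      have hc : e.snd ≠ v := hev ▸ e.adj.ne'
      refine (ih ⟨e.snd, hc⟩ rfl).trans ?_
      rw [pow_succ', mul_apply, ← he] at hdb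
      have h1 := color_next_snd h3 (d := f.dart e) (color_apply_ne hf _) (color_apply_ne hf _)
      have h2 := adj_next_snd_snd h3 (f.dart e)
      have h4 := adj_next_snd_snd h3 (R.next (f.dart e))
      have h5 := (R.next (f.dart e)).adj
      rw [← dart_twoParts_next h3 hf] at h4
      rw [R.next_fst] at h5
      refine reachable_around h3 hf h1 (v := v) ?_ h2 ?_
      · rw [← hev]; exact h5.symm
      · rw [← hdb]; exact h4.symm

end TwoParts

end RotationSystem

namespace SimpleGraph

theorem IsPlanarTriangulation.twoParts {V W : Type*} [Finite V] [Finite W] {H : SimpleGraph V}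
    {G : SimpleGraph W} (hG : G.IsPlanarTriangulation) {C : G.Coloring (Fin 3)} {i : Fin 3}
    (f : H ↪g G) (hf : ∀ w, w ∈ Set.range f ↔ C w ≠ i) :
    H.IsTwoVertexConnected ∧ H.IsBipartite ∧ H.IsPlanarGraph := by
  obtain ⟨hcard, hc, R, hR, hface⟩ := hG
  have h3 := RotationSystem.facePerm_facePerm_facePerm hface
  have : Nontrivial W := Finite.one_lt_card_iff_nontrivial.1 (by omega)
  have hd := hc.exists_dart_fst_eq
  have hdart := RotationSystem.natCard_dart_eq_three_mul h3 hf
  have hH : 0 < Nat.card H.Dart := by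
    have : Nonempty G.Dart := ⟨(hd (Classical.arbitrary W)).choose⟩
    have : 0 < Nat.card G.Dart := Nat.card_pos
    omega
  obtain ⟨d⟩ := (Nat.card_pos_iff.1 hH).1
  have : Nontrivial V := ⟨d.fst, d.snd, d.adj.ne⟩
  have hconn : H.Connected :=
    ⟨RotationSystem.preconnected_of_twoParts h3 hf hc.preconnected⟩
  refine ⟨⟨Finite.one_lt_card, hconn,
    RotationSystem.not_isCutVertex_of_twoParts h3 hf hc.preconnected⟩, ?_,
    RotationSystem.twoParts h3 hf, ?_⟩
  · let c : H.Coloring {j : Fin 3 // j ≠ i} :=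
      Coloring.mk (fun v => ⟨C (f v), (hf _).1 ⟨v, rfl⟩⟩) fun {u v} h e =>
        C.valid (f.map_rel_iff.2 h) (congrArg Subtype.val e)
    have := c.colorable
    rwa [Fintype.card_subtype_compl, Fintype.card_subtype_eq] at this
  · rw [RotationSystem.isPlanar_iff_of_connected _ hconn,
      RotationSystem.numCycles_twoParts_facePerm h3 hf hd]
    have e1 := (RotationSystem.isPlanar_iff_of_connected R hc).1 hR
    have e2 := Equiv.Perm.mul_numCycles_eq_natCard hface
    have e3 := natCard_dart_eq_two_mul H
    have e4 := natCard_dart_eq_two_mul G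
    have e5 : Nat.card W = Nat.card {w // C w = i} + Nat.card V := by
      rw [← Nat.card_congr (Equiv.sumCompl fun w => C w = i), Nat.card_sum]
      congr 1
      refine Nat.card_congr (Equiv.symm (Equiv.ofBijective
        (fun v => ⟨f v, (hf _).1 ⟨v, rfl⟩⟩) ⟨fun u v e => f.injective (congrArg Subtype.val e), ?_⟩))
      rintro ⟨w, hw⟩
      obtain ⟨v, rfl⟩ := (hf w).2 hw
      exact ⟨v, rfl⟩
    -- Here `E(G) = 3E(H)` and `F(G) = 2E(H)`, and the vertices of `G` are those of `H` together
    -- with its faces.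
    omega

end SimpleGraph

/-! ### From oriented to undirected graphs, and the main theorem -/

namespace Digraph

variable {V W : Type*} {D : Digraph V} {E : Digraph W}

/-- An isomorphism onto an induced subdigraph gives an embedding of the underlying graphs. -/
def embeddingOfInduceOn {s : Set W} (e : D.Adj ≃r (E.induceOn s).Adj) :
    D.toSimpleGraphInclusive ↪g E.toSimpleGraphInclusive where
  toFun v := e v
  inj' := Subtype.val_injective.comp e.injective
  map_rel_iff' {u v} := by
    have h (a b : V) : E.Adj (e a) (e b) ↔ D.Adj a b := e.map_rel_iff
    have h' : (e u : W) ≠ e v ↔ u ≠ v := (Subtype.val_injective.comp e.injective).ne_iff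
    change ((e u : W) ≠ e v ∧ _) ↔ (u ≠ v ∧ _)
    exact and_congr h' (or_congr (h u v) (h v u))

theorem IsOriented.ncard_neighborSet [Finite W] (hE : E.IsOriented) (v : W) :
    (E.toSimpleGraphInclusive.neighborSet v).ncard =
      {w | E.Adj v w}.ncard + {w | E.Adj w v}.ncard := by
  rw [← Set.ncard_union_eq]
  · congr 1
    ext w
    exact toSimpleGraphInclusive_adj_iff hE
  · exact Set.disjoint_left.2 fun w h h' => hE.2 _ _ h h'

theorem IsEulerianOriented.isEulerianGraph [Finite W] (hE : E.IsEulerianOriented) :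
    E.toSimpleGraphInclusive.IsEulerianGraph :=
  ⟨hE.2.1, fun v => ⟨_, by rw [hE.1.ncard_neighborSet, hE.2.2]⟩⟩

theorem IsInducedByTwoParts.toSimpleGraphInclusive {V : Type u} {D : Digraph V}
    (h : D.IsInducedByTwoParts) : D.toSimpleGraphInclusive.IsInducedByTwoParts := by
  obtain ⟨W, hW, E, C, i, hT, hE, ⟨e⟩⟩ := h
  refine ⟨W, hW, E.toSimpleGraphInclusive, C, i, hT, hE.isEulerianGraph, ⟨e.toEquiv, ?_⟩⟩
  exact (embeddingOfInduceOn e).map_rel_iff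

end Digraph

theorem SimpleGraph.IsInducedByTwoParts.isPlanarGraph {V : Type u} [Finite V] {H : SimpleGraph V}
    (h : H.IsInducedByTwoParts) :
    H.IsTwoVertexConnected ∧ H.IsBipartite ∧ H.IsPlanarGraph := by
  obtain ⟨W, hW, G, C, i, hT, -, ⟨e⟩⟩ := h
  refine hT.twoParts (C := C) (i := i) (e.toEmbedding.trans (Embedding.induce _)) fun w => ?_
  constructor
  · rintro ⟨v, rfl⟩
    exact (e v).2
  · intro hw
    exact ⟨e.symm ⟨w, hw⟩, congrArg Subtype.val (e.apply_symm_apply ⟨w, hw⟩)⟩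

/-- A 2-coloured graph has an orientation: direct every edge from colour `0` to colour `1`. -/
theorem SimpleGraph.IsBipartite.exists_isOriented {V : Type*} {H : SimpleGraph V}
    (hb : H.IsBipartite) : ∃ D : Digraph V, D.IsOriented ∧ D.toSimpleGraphInclusive = H := by
  obtain ⟨c⟩ := hb
  let D : Digraph V := ⟨fun u v => H.Adj u v ∧ c u = 0⟩
  have hD : D.IsOriented :=
    ⟨fun v h => H.irrefl h.1, fun u v h h' => c.valid h.1 (h.2.trans h'.2.symm)⟩
  refine ⟨D, hD, ?_⟩
  ext u v
  rw [Digraph.toSimpleGraphInclusive_adj_iff hD]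
  refine ⟨fun h => h.elim (·.1) (·.1.symm), fun h => ?_⟩
  have := c.valid h
  rcases eq_or_ne (c u) 0 with h0 | h0
  · exact .inl ⟨h, h0⟩
  · exact .inr ⟨h.symm, by omega⟩

theorem mainTheorem7 :
    (∀ (V : Type u) [Finite V] (H : SimpleGraph V),
      H.IsInducedByTwoParts ↔
        H.IsTwoVertexConnected ∧ H.IsBipartite ∧ H.IsPlanarGraph) ∧
    (∀ (V : Type u) [Finite V] (H : Digraph V), H.IsOriented →
      (H.IsInducedByTwoParts ↔
        H.toSimpleGraphInclusive.IsTwoVertexConnected ∧ H.toSimpleGraphInclusive.IsBipartite ∧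
          H.toSimpleGraphInclusive.IsPlanarGraph)) := by
  have h2 : ∀ (V : Type u) [Finite V] (H : Digraph V), H.IsOriented →
      (H.IsInducedByTwoParts ↔
        H.toSimpleGraphInclusive.IsTwoVertexConnected ∧ H.toSimpleGraphInclusive.IsBipartite ∧
          H.toSimpleGraphInclusive.IsPlanarGraph) := fun V _ H hH =>
    ⟨fun h => h.toSimpleGraphInclusive.isPlanarGraph,
      fun h => Digraph.isInducedByTwoParts_of_isPlanarGraph hH h.1 h.2.1 h.2.2⟩
  refine ⟨fun V _ H => ⟨fun h => h.isPlanarGraph, fun h => ?_⟩, h2⟩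
  -- Any orientation serves, since the oriented statement extends it to an Eulerian one.
  obtain ⟨D, hD, rfl⟩ := h.2.1.exists_isOriented
  exact ((h2 V D hD).2 h).toSimpleGraphInclusive
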